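/- (Ito's theorem) Let $G$ be a finite group and let $A$ be an abelian normal subgroup of $G$. Then for every irreducible complex character $\chi$ of $G$ the degree $\deg\chi=\chi(1)$ (the dimension of a complex representation of $G$ with character $\chi$) divides the index $|G:A|$. -/

import Mathlib

/-- `ordIrr G` is the set `Irr(G)` of irreducible ordinary (complex) characters of `G`: the functions
`g ↦ tr (ρ g)` where `ρ` is an irreducible complex representation of finite degree `n`. -/
def ordIrr (G : Type*) [Group G] : Set (G → ℂ) :=
  {χ | ∃ (n : ℕ) (ρ : Representation ℂ G (Fin n → ℂ)), ρ.IsIrreducible ∧ ρ.character = χ}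

/-- The degree of an ordinary character `χ`: the degree `n` of a complex representation with
character `χ`. This `n` is unique (see `charDegree_character`), so the infimum is over a
one-element set whenever `χ` is a character. -/
noncomputable def charDegree {G : Type*} [Group G] (χ : G → ℂ) : ℕ :=
  sInf {n : ℕ | ∃ ρ : Representation ℂ G (Fin n → ℂ), ρ.character = χ}

/-- The degree of the character of a representation of degree `n` is `n`. -/
theorem charDegree_character {G : Type*} [Group G] {n : ℕ}
    (ρ : Representation ℂ G (Fin n → ℂ)) : charDegree ρ.character = n := by
  have h : {m : ℕ | ∃ σ : Representation ℂ G (Fin m → ℂ), σ.character = ρ.character} = {n} := by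
    ext m
    constructor
    · rintro ⟨σ, hσ⟩
      have h1 := congrFun hσ 1
      rw [Representation.char_one, Representation.char_one] at h1
      simpa using h1
    · rintro rfl
      exact ⟨ρ, rfl⟩
  rw [charDegree, h, csInf_singleton]

/-- `deg χ = χ(1)` for every irreducible ordinary character `χ`. -/
theorem charDegree_eq_apply_one {G : Type*} [Group G] {χ : G → ℂ} (hχ : χ ∈ ordIrr G) :
    (charDegree χ : ℂ) = χ 1 := by
  obtain ⟨n, ρ, -, rfl⟩ := hχ
  rw [charDegree_character, Representation.char_one]
  simp

open scoped IsMulCommutative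

/-! Let `n` be the degree and let `p ψ` project onto the `ψ`-isotypic component of the restriction
to `A`. Schur orthogonality, averaged over `A` first, gives `(|G:A|/n) w ⊗ u = ∑ q, ∑ ψ, (ρ q)(p ψ)
u ⊗ (p ψ)(ρ q)⁻¹ w`, with `q` over coset representatives (`sum_quotient_isotypicProj`); no
denominators remain on the right. As `A` is normal, `G` permutes the `p ψ`, so the vectors `(p ψ)(ρ
g) v` together with `0` form a finite set stable under all `(p ψ)(ρ g)`. The integer span of their
tensors is finitely generated, nonzero and stable under `|G:A|/n`, which is thus an algebraic
integer; being rational, it is an integer. -/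

/-- The projection onto the isotypic component of the character `ψ` of a finite abelian group. -/
noncomputable def isotypicProj {B V : Type*} [CommGroup B] [Fintype B] [AddCommGroup V] [Module ℂ V]
    (τ : Representation ℂ B V) (ψ : AddChar (Additive B) ℂ) : Module.End ℂ V :=
  (Fintype.card B : ℂ)⁻¹ • ∑ b : B, ψ (-Additive.ofMul b) • τ b

section Isotypic

variable {B V : Type*} [CommGroup B] [Fintype B] [AddCommGroup V] [Module ℂ V]
  (τ : Representation ℂ B V)

theorem isotypicProj_mul_apply (ψ : AddChar (Additive B) ℂ) (c : B) :
    isotypicProj τ ψ * τ c = ψ (Additive.ofMul c) • isotypicProj τ ψ := by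
  simp only [isotypicProj]
  rw [smul_mul_assoc, smul_comm, Finset.sum_mul, Finset.smul_sum (r := ψ _)]
  congr 1
  refine Fintype.sum_equiv (Equiv.mulRight c) _ _ fun b ↦ ?_
  rw [Equiv.coe_mulRight, map_mul τ, smul_mul_assoc, smul_smul, ← AddChar.map_add_eq_mul,
    ofMul_mul]
  congr 2
  abel

theorem isotypicProj_mul_isotypicProj [DecidableEq (AddChar (Additive B) ℂ)]
    (ψ χ : AddChar (Additive B) ℂ) :
    isotypicProj τ ψ * isotypicProj τ χ = if ψ = χ then isotypicProj τ ψ else 0 := by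
  have hsum : ∑ b : B, χ (-Additive.ofMul b) * ψ (Additive.ofMul b)
      = if ψ = χ then (Fintype.card B : ℂ) else 0 := by
    have h := AddChar.sum_eq_ite (ψ - χ)
    simp only [sub_eq_zero] at h
    rw [Fintype.card_additive] at h
    rw [← h]
    refine Fintype.sum_equiv Additive.ofMul _ _ fun b ↦ ?_
    rw [AddChar.sub_apply, mul_comm]
  have hB : (Fintype.card B : ℂ) ≠ 0 := Nat.cast_ne_zero.2 Fintype.card_ne_zero
  conv_lhs => rw [isotypicProj.eq_def τ χ]
  simp_rw [mul_smul_comm, Finset.mul_sum, mul_smul_comm, isotypicProj_mul_apply, smul_smul]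
  rw [← Finset.sum_smul, hsum, smul_smul]
  split_ifs <;> simp [hB]

/-- Expanding both projections gives a double sum over `a`, `b` weighted by `∑ ψ, ψ (ab)⁻¹`, which
vanishes unless `b = a⁻¹`. -/
theorem sum_isotypicProj_mul_isotypicProj (φ η : Module.Dual ℂ V) (u w : V) :
    ∑ ψ, φ (isotypicProj τ ψ u) * η (isotypicProj τ ψ w)
      = (Fintype.card B : ℂ)⁻¹ * ∑ b : B, φ (τ b u) * η (τ b⁻¹ w) := by
  classical
  have hB : (Fintype.card B : ℂ) ≠ 0 := Nat.cast_ne_zero.2 Fintype.card_ne_zero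
  have hψ (ψ : AddChar (Additive B) ℂ) : φ (isotypicProj τ ψ u) * η (isotypicProj τ ψ w)
      = ∑ a : B, ∑ b : B, (Fintype.card B : ℂ)⁻¹ ^ 2 * (φ (τ a u) * η (τ b w)) *
          ψ (-Additive.ofMul (a * b)) := by
    simp only [isotypicProj, LinearMap.smul_apply, LinearMap.sum_apply, map_smul, map_sum,
      smul_eq_mul]
    rw [mul_mul_mul_comm, Finset.sum_mul_sum, Finset.mul_sum]
    refine Finset.sum_congr rfl fun a _ ↦ ?_
    rw [Finset.mul_sum]
    refine Finset.sum_congr rfl fun b _ ↦ ?_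
    rw [ofMul_mul, neg_add, AddChar.map_add_eq_mul]
    ring
  simp_rw [hψ]
  rw [Finset.sum_comm, Finset.mul_sum]
  refine Finset.sum_congr rfl fun a _ ↦ ?_
  rw [Finset.sum_comm, Finset.sum_eq_single a⁻¹]
  · rw [← Finset.mul_sum, AddChar.sum_apply_eq_ite, mul_inv_cancel, ofMul_one, neg_zero,
      if_pos rfl, Fintype.card_additive]
    field_simp
  · intro b _ hb
    rw [← Finset.mul_sum, AddChar.sum_apply_eq_ite, if_neg, mul_zero]
    rw [neg_eq_zero, ofMul_eq_zero]
    exact fun h ↦ hb (eq_inv_of_mul_eq_one_right h)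
  · simp

end Isotypic

/-- Schur orthogonality for the matrix coefficients of an irreducible representation. -/
theorem Representation.IsIrreducible.sum_dual_mul_dual_inv {G V : Type*} [Group G] [Fintype G]
    [AddCommGroup V] [Module ℂ V] [FiniteDimensional ℂ V] (ρ : Representation ℂ G V)
    [ρ.IsIrreducible] (φ η : Module.Dual ℂ V) (u w : V) :
    (Module.finrank ℂ V : ℂ) * ∑ g : G, φ (ρ g u) * η (ρ g⁻¹ w)
      = Fintype.card G * (φ w * η u) := by
  -- The rank-one map `v ↦ η v • u`, summed over its conjugates, is a scalar `c` by Schur's lemma;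
  -- the trace gives `c * dim V = |G| * η u`.
  let T : Module.End ℂ V := ∑ g : G, ρ g * η.smulRight u * ρ g⁻¹
  have hT (h : G) (v : V) : T (ρ h v) = ρ h (T v) := by
    have : T * ρ h = ρ h * T := by
      simp only [T, Finset.sum_mul, Finset.mul_sum]
      refine Fintype.sum_equiv (Equiv.mulLeft h⁻¹) _ _ fun g ↦ ?_
      simp only [Equiv.coe_mulLeft, mul_assoc, ← map_mul, mul_inv_rev, inv_inv]
      simp only [← mul_assoc, ← map_mul, mul_inv_cancel, one_mul]
    exact LinearMap.congr_fun this v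
  obtain ⟨c, hc⟩ := (algebraMap_intertwiningMap_bijective_of_isAlgClosed (ρ := ρ)).2
    (T.intertwiningMap_of_isIntertwiningMap ρ ρ hT)
  have hTc : T = c • (1 : Module.End ℂ V) := by
    ext v
    exact (congrArg (fun f : IntertwiningMap ρ ρ ↦ f v) hc).symm
  have htr : (Fintype.card G : ℂ) * η u = c * Module.finrank ℂ V := by
    have h := congrArg (LinearMap.trace ℂ V) hTc
    simp only [T, map_sum, map_smul, LinearMap.trace_one, smul_eq_mul] at h
    rw [← h, Finset.sum_congr rfl (g := fun _ ↦ η u)]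
    · simp
    · intro g _
      rw [mul_assoc, LinearMap.trace_mul_comm, mul_assoc, ← map_mul, inv_mul_cancel, map_one,
        mul_one, LinearMap.trace_smulRight]
  have hw : ∑ g : G, φ (ρ g u) * η (ρ g⁻¹ w) = c * φ w := by
    have h := congrArg φ (LinearMap.congr_fun hTc w)
    simp only [T, LinearMap.sum_apply, map_sum, LinearMap.smul_apply, map_smul,
      Module.End.mul_apply, LinearMap.smulRight_apply, smul_eq_mul, Module.End.one_apply] at h
    rw [← h]
    exact Finset.sum_congr rfl fun g _ ↦ mul_comm _ _
  rw [hw, mul_left_comm (Fintype.card G : ℂ), htr]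
  ring

theorem Subgroup.bijective_out_mul {G : Type*} [Group G] (A : Subgroup G) :
    Function.Bijective fun x : (G ⧸ A) × A ↦ x.1.out * (x.2 : G) := by
  refine ⟨fun ⟨q, a⟩ ⟨r, b⟩ h ↦ ?_, fun g ↦ ?_⟩
  · have hqr : q = r := by
      have h' := congrArg (QuotientGroup.mk (s := A)) h
      simpa using h'
    subst hqr
    exact Prod.ext rfl (Subtype.ext (mul_left_cancel h))
  · refine ⟨⟨g, (g : G ⧸ A).out⁻¹ * g, ?_⟩, mul_inv_cancel_left _ _⟩
    exact QuotientGroup.eq.1 (QuotientGroup.out_eq' _)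

section AbelianSubgroup

variable {G V : Type*} [Group G] (A : Subgroup G) [IsMulCommutative A] [Fintype A]
  [AddCommGroup V] [Module ℂ V] (ρ : Representation ℂ G V)

/-- Conjugation by `g` permutes the characters of `A`, and `ρ g` permutes the isotypic components
accordingly. -/
theorem apply_mul_isotypicProj [A.Normal] (g : G) (ψ : AddChar (Additive A) ℂ) :
    ρ g * isotypicProj (ρ.comp A.subtype) ψ = isotypicProj (ρ.comp A.subtype)
      (ψ.compAddMonoidHom (MulAut.conjNormal (H := A) g⁻¹).toMonoidHom.toAdditive) * ρ g := by
  simp only [isotypicProj, mul_smul_comm, smul_mul_assoc, Finset.mul_sum, Finset.sum_mul]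
  congr 1
  refine Fintype.sum_equiv (MulAut.conjNormal (H := A) g).toEquiv _ _ fun a ↦ ?_
  have h1 : MulAut.conjNormal (H := A) g⁻¹ (MulAut.conjNormal (H := A) g a) = a := by
    rw [← MulAut.mul_apply, ← map_mul, inv_mul_cancel, map_one, MulAut.one_apply]
  have h2 : ψ.compAddMonoidHom (MulAut.conjNormal (H := A) g⁻¹).toMonoidHom.toAdditive
      (-Additive.ofMul (MulAut.conjNormal (H := A) g a)) = ψ (-Additive.ofMul a) := by
    conv_rhs => rw [← h1]
    rw [AddChar.compAddMonoidHom_apply, map_neg]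
    rfl
  simp only [MulEquiv.toEquiv_eq_coe, MulEquiv.coe_toEquiv]
  rw [h2]
  congr 1
  simp only [MonoidHom.comp_apply, Subgroup.coe_subtype, MulAut.conjNormal_apply]
  rw [← map_mul, ← map_mul, inv_mul_cancel_right]

/-- Moving the right projection past `ρ g` leaves a product of two projections from one orthogonal
family. This is what keeps the set of vectors finite. -/
theorem isotypicProj_mul_apply_mul_isotypicProj [A.Normal] (g : G)
    (ψ χ : AddChar (Additive A) ℂ) :
    isotypicProj (ρ.comp A.subtype) ψ * ρ g * isotypicProj (ρ.comp A.subtype) χ = 0 ∨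
    isotypicProj (ρ.comp A.subtype) ψ * ρ g * isotypicProj (ρ.comp A.subtype) χ =
      isotypicProj (ρ.comp A.subtype) ψ * ρ g := by
  classical
  rw [mul_assoc, apply_mul_isotypicProj, ← mul_assoc, isotypicProj_mul_isotypicProj]
  split_ifs <;> simp

/-- Schur orthogonality for an irreducible representation, with the average over an abelian
subgroup carried out by means of its isotypic projections. -/
theorem sum_quotient_isotypicProj [Fintype G] [Fintype (G ⧸ A)] [FiniteDimensional ℂ V] [ρ.IsIrreducible]
    (φ η : Module.Dual ℂ V) (u w : V) :
    (Module.finrank ℂ V : ℂ) * ∑ q : G ⧸ A, ∑ ψ,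
      φ ((ρ q.out * isotypicProj (ρ.comp A.subtype) ψ) u) *
        η ((isotypicProj (ρ.comp A.subtype) ψ * ρ q.out⁻¹) w)
      = A.index * (φ w * η u) := by
  have hA : (Fintype.card A : ℂ) ≠ 0 := Nat.cast_ne_zero.2 Fintype.card_ne_zero
  have hq (q : G ⧸ A) : ∑ ψ, φ ((ρ q.out * isotypicProj (ρ.comp A.subtype) ψ) u) *
        η ((isotypicProj (ρ.comp A.subtype) ψ * ρ q.out⁻¹) w)
      = (Fintype.card A : ℂ)⁻¹ * ∑ a : A, φ (ρ (q.out * a) u) * η (ρ (q.out * a)⁻¹ w) := by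
    have h := sum_isotypicProj_mul_isotypicProj (ρ.comp A.subtype) (φ ∘ₗ ρ q.out) η u
      (ρ q.out⁻¹ w)
    simpa [map_mul, mul_inv_rev] using h
  have hG : ∑ q : G ⧸ A, ∑ a : A, φ (ρ (q.out * a) u) * η (ρ (q.out * a)⁻¹ w)
      = ∑ g : G, φ (ρ g u) * η (ρ g⁻¹ w) := by
    rw [← Fintype.sum_prod_type']
    exact Fintype.sum_bijective _ A.bijective_out_mul _ _ fun x ↦ rfl
  have hS := Representation.IsIrreducible.sum_dual_mul_dual_inv ρ φ η u w
  have hcard : (Fintype.card G : ℂ) = A.index * Fintype.card A := by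
    rw [← Nat.card_eq_fintype_card, ← Nat.card_eq_fintype_card, ← A.index_mul_card, Nat.cast_mul]
  simp_rw [hq, ← Finset.mul_sum]
  rw [hG, mul_left_comm, hS, hcard]
  field_simp

end AbelianSubgroup

theorem isIntegral_index_div_finrank {G : Type*} [Group G] [Fintype G] (A : Subgroup G)
    [A.Normal] [IsMulCommutative A] {n : ℕ} (ρ : Representation ℂ G (Fin n → ℂ))
    [ρ.IsIrreducible] (hn : n ≠ 0) : IsIntegral ℤ ((A.index : ℂ) / n) := by
  classical
  have : Fintype A := Fintype.ofFinite A
  have : Fintype (G ⧸ A) := Fintype.ofFinite _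
  let p := isotypicProj (ρ.comp A.subtype)
  -- The tensor `w ⊗ u` is modelled by the matrix `Matrix.vecMulVec w u`; the two factors change
  -- places on the right.
  have key (u w : Fin n → ℂ) : ((A.index : ℂ) / n) • Matrix.vecMulVec w u
      = ∑ q : G ⧸ A, ∑ ψ, Matrix.vecMulVec ((ρ q.out * p ψ) u) ((p ψ * ρ q.out⁻¹) w) := by
    ext i j
    have h := sum_quotient_isotypicProj A ρ (LinearMap.proj i) (LinearMap.proj j) u w
    rw [Module.finrank_fin_fun] at h
    simp only [LinearMap.proj_apply] at h
    have hn' : (n : ℂ) ≠ 0 := Nat.cast_ne_zero.2 hn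
    simp only [Matrix.smul_apply, Matrix.sum_apply, Matrix.vecMulVec_apply, smul_eq_mul]
    rw [div_mul_eq_mul_div, div_eq_iff hn', ← h, mul_comm]
  have : Nonempty (Fin n) := Fin.pos_iff_nonempty.1 (Nat.pos_of_ne_zero hn)
  let v : Fin n → ℂ := 1
  let S : Set (Fin n → ℂ) :=
    insert 0 (Set.range fun x : AddChar (Additive A) ℂ × G ↦ (p x.1 * ρ x.2) v)
  have hS : S.Finite := (Set.finite_range _).insert 0
  have hmem (ψ : AddChar (Additive A) ℂ) (g : G) : (p ψ * ρ g) v ∈ S := .inr ⟨(ψ, g), rfl⟩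
  have hstab (ψ : AddChar (Additive A) ℂ) (g : G) {x : Fin n → ℂ} (hx : x ∈ S) :
      (p ψ * ρ g) x ∈ S := by
    obtain rfl | ⟨⟨χ, h⟩, rfl⟩ := hx
    · exact .inl (map_zero _)
    · change (p ψ * ρ g * p χ) (ρ h v) ∈ S
      obtain h0 | h0 := isotypicProj_mul_apply_mul_isotypicProj A ρ g ψ χ
      · exact .inl (by rw [h0, LinearMap.zero_apply])
      · rw [h0]
        have := hmem ψ (g * h)
        rwa [map_mul, ← mul_assoc] at this
  have hstab' (ψ : AddChar (Additive A) ℂ) (g : G) {x : Fin n → ℂ} (hx : x ∈ S) :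
      (ρ g * p ψ) x ∈ S := by
    rw [apply_mul_isotypicProj]
    exact hstab _ _ hx
  let N : Submodule ℤ (Matrix (Fin n) (Fin n) ℂ) :=
    Submodule.span ℤ (Set.image2 Matrix.vecMulVec S S)
  have hN {x y : Fin n → ℂ} (hx : x ∈ S) (hy : y ∈ S) : Matrix.vecMulVec x y ∈ N :=
    Submodule.subset_span (Set.mem_image2_of_mem hx hy)
  refine isIntegral_of_smul_mem_submodule N (fun hbot ↦ ?_)
    (Submodule.fg_span (hS.image2 _ hS)) _ fun m hm ↦ ?_
  -- The vector `v` need not lie in `S`, but `key` puts this multiple of `v ⊗ v` in `N`, and all its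
  -- entries are nonzero.
  · have h : ((A.index : ℂ) / n) • Matrix.vecMulVec v v ∈ N := by
      rw [key]
      refine Submodule.sum_mem _ fun q _ ↦ Submodule.sum_mem _ fun ψ _ ↦ hN ?_ (hmem _ _)
      rw [apply_mul_isotypicProj]
      exact hmem _ _
    rw [hbot, Submodule.mem_bot] at h
    obtain ⟨i⟩ := this
    have h' := congrFun (congrFun h i) i
    simp [v, hn, A.index_ne_zero_of_finite] at h'
  · induction hm using Submodule.span_induction with
    | mem m hm =>
      obtain ⟨x, hx, y, hy, rfl⟩ := hm
      rw [key]
      exact Submodule.sum_mem _ fun q _ ↦ Submodule.sum_mem _ fun ψ _ ↦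
        hN (hstab' _ _ hy) (hstab _ _ hx)
    | zero => simp
    | add a b _ _ ha hb => rw [smul_add]; exact N.add_mem ha hb
    | smul k a _ ha => rw [smul_comm]; exact N.smul_mem k ha

theorem Nat.dvd_of_isIntegral_div {m n : ℕ} (hn : n ≠ 0) (h : IsIntegral ℤ ((m : ℂ) / n)) :
    n ∣ m := by
  have hq : IsIntegral ℤ ((m : ℚ) / n) := by
    rw [← isIntegral_algebraMap_iff (algebraMap ℚ ℂ).injective]
    simpa using h
  obtain ⟨k, hk⟩ := IsIntegrallyClosed.isIntegral_iff.1 hq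
  rw [eq_div_iff (Nat.cast_ne_zero.2 hn)] at hk
  exact Int.natCast_dvd_natCast.1 ⟨k, by
    rw [mul_comm]
    exact (Int.cast_injective (α := ℚ) (by simpa using hk)).symm⟩

theorem mainTheorem4 {G : Type*} [Group G] [Finite G] (A : Subgroup G) (hnormal : A.Normal)
    (hcomm : ∀ a ∈ A, ∀ b ∈ A, a * b = b * a) (χ : G → ℂ) (hχ : χ ∈ ordIrr G) :
    charDegree χ ∣ A.index := by
  obtain ⟨n, ρ, hρ, rfl⟩ := hχ
  rw [charDegree_character]
  have : Fintype G := Fintype.ofFinite G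
  have : IsMulCommutative A := ⟨⟨fun a b ↦ Subtype.ext (hcomm a a.2 b b.2)⟩⟩
  have hn : n ≠ 0 := by
    rintro rfl
    obtain ⟨x, y, hxy⟩ := hρ.toNontrivial
    exact hxy (SetLike.ext fun v ↦ by
      rw [Subsingleton.elim v 0]
      exact iff_of_true x.toSubmodule.zero_mem y.toSubmodule.zero_mem)
  exact Nat.dvd_of_isIntegral_div hn (isIntegral_index_div_finrank A ρ hn)
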